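/- Conventions. A $(\vee,0)$-semilattice is a join-semilattice with a least element $0$; a $(\vee,0,1)$-semilattice has, in addition, a greatest element $1$; $(\vee,0)$-homomorphisms preserve $\vee$ and $0$, and $(\vee,0,1)$-homomorphisms preserve also $1$. Classes of semilattices are considered up to isomorphism. For a nonempty algebra $A$, $\mathrm{Con}_c A$ is the $(\vee,0)$-semilattice of compact elements of the congruence lattice $\mathrm{Con}\,A$; for a homomorphism $f\colon A\to B$, the map $\mathrm{Con}_c f\colon \mathrm{Con}_c A\to\mathrm{Con}_c B$ sends $\alpha$ to the congruence of $B$ generated by $\{(f(x),f(y)) : (x,y)\in\alpha\}$. This defines a functor $\mathrm{Con}_c$ from a variety (with all homomorphisms as arrows) to $(\vee,0)$-semilattices. A lifting in a variety $\mathcal V$ of a semilattice $S$ is an algebra $A\in\mathcal V$ with $\mathrm{Con}_c A\cong S$; a lifting in $\mathcal V$ of a diagram $\mathcal D\colon P\to\mathcal S$ indexed by a poset $P$ is a functor $\mathcal A\colon P\to\mathcal V$ such that $\mathrm{Con}_c\circ\mathcal A$ is naturally isomorphic to $\mathcal D$. A well-founded tree is a poset $T$ with a smallest element such that $\{s\in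 T : s\le t\}$ is a well-founded chain for every $t\in T$. A directed union is the union of a nonempty upward directed set of $(\vee,0)$-subsemilattices; it preserves $0$ and $1$ if the union has a greatest element and this element belongs to all those subsemilattices. Corollary. Let $\mathscr L$ be a similarity type with finitary operation symbols, and let $\mathcal V$ be a variety of $\mathscr L$-algebras. (1) Let $\mathcal S$ be a class of $(\vee,0)$-semilattices closed under (nonempty) finite products and directed unions. If every $S\in\mathcal S$ has a lifting in $\mathcal V$, then every diagram of members of $\mathcal S$ and $(\vee,0)$-homomorphisms, indexed by a finite product of well-founded trees, has a lifting in $\mathcal V$. (2) Let $\mathcal S$ be a class of $(\vee,0,1)$-semilattices closed under (nonempty) finite products and directed unions preserving $0$ and $1$. If every $S\in\mathcal S$ has a lifting in $\mathcal V$, then every diagram of members of $\mathcal S$ and $(\vee,0,1)$-homomorphisms, indexed by a finite product of well-founded trees, has a lifting in $\mathcal V$. -/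

import Mathlib

open CategoryTheory
open scoped FirstOrder

universe u

namespace CongLift

/-! ### Congruences of an algebra -/

section Congruences

/-- A congruence of an `L`-algebra `A`: an equivalence relation compatible with all operations. -/
@[ext]
structure Con (L : FirstOrder.Language.{u, u}) (A : Type u) [L.Structure A] where
  /-- The underlying binary relation. -/
  rel : A → A → Prop
  equiv : Equivalence rel
  compat : ∀ {n : ℕ} (f : L.Functions n) (x y : Fin n → A), (∀ i, rel (x i) (y i)) →
    rel (FirstOrder.Language.Structure.funMap f x) (FirstOrder.Language.Structure.funMap f y)

variable {L : FirstOrder.Language.{u, u}} {A B C : Type u} [L.Structure A] [L.Structure B] [L.Structure C]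

/-- Congruences are ordered by inclusion. -/
instance : PartialOrder (Con L A) where
  le α β := ∀ x y, α.rel x y → β.rel x y
  le_refl _ _ _ h := h
  le_trans _ _ _ h₁ h₂ x y h := h₂ x y (h₁ x y h)
  le_antisymm α β h₁ h₂ := by
    ext x y
    exact ⟨h₁ x y, h₂ x y⟩

/-- The meet of a set of congruences is their intersection. -/
instance : InfSet (Con L A) where
  sInf S :=
    { rel := fun x y => ∀ α ∈ S, α.rel x y
      equiv := ⟨fun x α _ => α.equiv.refl x, fun h α hα => α.equiv.symm (h α hα),
        fun h₁ h₂ α hα => α.equiv.trans (h₁ α hα) (h₂ α hα)⟩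
      compat := fun f x y h α hα => α.compat f x y (fun i => h i α hα) }

theorem Con.isGLB_sInf (S : Set (Con L A)) : IsGLB S (sInf S) :=
  ⟨fun _ hα _ _ h => h _ hα, fun _ hβ x y h _ hα => hβ hα x y h⟩

/-- The complete lattice `Con A` of all congruences of `A`. -/
instance : CompleteLattice (Con L A) :=
  completeLatticeOfInf (Con L A) Con.isGLB_sInf

/-- The congruence generated by a binary relation. -/
def Con.gen (r : A → A → Prop) : Con L A :=
  sInf {θ | ∀ x y, r x y → θ.rel x y}

theorem Con.gen_le {r : A → A → Prop} {θ : Con L A} :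
    Con.gen r ≤ θ ↔ ∀ x y, r x y → θ.rel x y :=
  ⟨fun h x y hr => h x y (fun _ hα => hα x y hr), fun h _ _ hg => hg θ h⟩

/-- `Con f`: it sends a congruence `α` of `A` to the congruence of `B` generated by
all pairs `(f x, f y)` with `(x, y) ∈ α`. -/
def Con.map (f : A →[L] B) (α : Con L A) : Con L B :=
  Con.gen fun b b' => ∃ x y, α.rel x y ∧ f x = b ∧ f y = b'

/-- The inverse image of a congruence. -/
def Con.comap (f : A →[L] B) (β : Con L B) : Con L A where
  rel x y := β.rel (f x) (f y)
  equiv := ⟨fun _ => β.equiv.refl _, fun h => β.equiv.symm h, fun h₁ h₂ => β.equiv.trans h₁ h₂⟩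
  compat g x y h := by
    rw [f.map_fun, f.map_fun]
    exact β.compat g _ _ h

theorem Con.map_comap_gc (f : A →[L] B) : GaloisConnection (Con.map f) (Con.comap f) := by
  intro α β
  rw [Con.map, Con.gen_le]
  constructor
  · intro h x y hxy
    exact h _ _ ⟨x, y, hxy, rfl, rfl⟩
  · rintro h _ _ ⟨x, y, hxy, rfl, rfl⟩
    exact h x y hxy

/-- The join of a nonempty directed set of congruences is its union. -/
theorem Con.sSup_rel_of_directedOn {S : Set (Con L A)} (hne : S.Nonempty)
    (hdir : DirectedOn (· ≤ ·) S) {x y : A} (h : (sSup S).rel x y) : ∃ α ∈ S, α.rel x y := by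
  have key : ∀ (n : ℕ) (a b : Fin n → A), (∀ i, ∃ α ∈ S, α.rel (a i) (b i)) →
      ∃ α ∈ S, ∀ i, α.rel (a i) (b i) := by
    intro n
    induction n with
    | zero => intro a b _; exact ⟨hne.some, hne.some_mem, fun i => i.elim0⟩
    | succ n ih =>
      intro a b hab
      obtain ⟨α, hα, h₁⟩ := ih (fun i => a i.succ) (fun i => b i.succ) (fun i => hab i.succ)
      obtain ⟨β, hβ, h₂⟩ := hab 0
      obtain ⟨γ, hγ, hαγ, hβγ⟩ := hdir α hα β hβ
      refine ⟨γ, hγ, fun i => ?_⟩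
      refine Fin.cases ?_ (fun j => ?_) i
      · exact hβγ _ _ h₂
      · exact hαγ _ _ (h₁ j)
  let U : Con L A :=
    { rel := fun x y => ∃ α ∈ S, α.rel x y
      equiv := ⟨fun x => ⟨hne.some, hne.some_mem, hne.some.equiv.refl x⟩,
        fun ⟨α, hα, h⟩ => ⟨α, hα, α.equiv.symm h⟩,
        fun ⟨α, hα, h₁⟩ ⟨β, hβ, h₂⟩ => by
          obtain ⟨γ, hγ, hαγ, hβγ⟩ := hdir α hα β hβ
          exact ⟨γ, hγ, γ.equiv.trans (hαγ _ _ h₁) (hβγ _ _ h₂)⟩⟩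
      compat := fun f a b hab => by
        obtain ⟨α, hα, h⟩ := key _ a b hab
        exact ⟨α, hα, α.compat f a b h⟩ }
  have hU : sSup S ≤ U := sSup_le fun α hα x y hxy => ⟨α, hα, hxy⟩
  exact hU x y h

/-- `Con f` sends compact congruences to compact congruences. -/
theorem Con.isCompactElement_map (f : A →[L] B) {α : Con L A} (hα : IsCompactElement α) :
    IsCompactElement (Con.map f α) := by
  rw [CompleteLattice.isCompactElement_iff_le_of_directed_sSup_le] at hα ⊢
  intro S hne hdir hle
  have hle' : α ≤ sSup (Con.comap f '' S) := by
    intro x y hxy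
    obtain ⟨β, hβ, h⟩ := Con.sSup_rel_of_directedOn hne hdir
      ((Con.map_comap_gc f).le_iff_le.1 hle x y hxy)
    exact le_sSup (Set.mem_image_of_mem (Con.comap f) hβ) x y h
  obtain ⟨_, ⟨β, hβ, rfl⟩, h⟩ := hα _ (hne.image _)
    (hdir.mono_comp fun _ _ h => (Con.map_comap_gc f).monotone_u h) hle'
  exact ⟨β, hβ, (Con.map_comap_gc f).le_iff_le.2 h⟩

theorem Con.map_id (α : Con L A) : Con.map (FirstOrder.Language.Hom.id L A) α = α :=
  le_antisymm ((Con.map_comap_gc _).l_le fun _ _ h => h)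
    ((Con.map_comap_gc (FirstOrder.Language.Hom.id L A)).le_u_l α)

theorem Con.map_comp (g : B →[L] C) (f : A →[L] B) (α : Con L A) :
    Con.map (g.comp f) α = Con.map g (Con.map f α) :=
  ((Con.map_comap_gc f).compose (Con.map_comap_gc g)).l_unique
    (Con.map_comap_gc (g.comp f)) (fun _ => rfl) |>.symm

variable (L A) in
/-- `Conc A`: the compact congruences of `A`, ordered by inclusion. -/
def Conc : Type u := {α : Con L A // IsCompactElement α}

theorem Con.isCompactElement_sup {α β : Con L A} (hα : IsCompactElement α)
    (hβ : IsCompactElement β) : IsCompactElement (α ⊔ β) := by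
  rw [CompleteLattice.isCompactElement_iff_le_of_directed_sSup_le] at hα hβ ⊢
  intro S hne hdir hle
  obtain ⟨x, hx, hαx⟩ := hα S hne hdir (le_sup_left.trans hle)
  obtain ⟨y, hy, hβy⟩ := hβ S hne hdir (le_sup_right.trans hle)
  obtain ⟨z, hz, hxz, hyz⟩ := hdir x hx y hy
  exact ⟨z, hz, sup_le (hαx.trans hxz) (hβy.trans hyz)⟩

instance : SemilatticeSup (Conc L A) :=
  Subtype.semilatticeSup fun _ _ h₁ h₂ => Con.isCompactElement_sup h₁ h₂

instance : OrderBot (Conc L A) :=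
  Subtype.orderBot fun _ _ hne _ _ _ => ⟨hne.some, hne.some_mem, bot_le⟩

/-- `Conc f`: the restriction of `Con f` to the compact congruences. -/
def Conc.map (f : A →[L] B) : SupBotHom (Conc L A) (Conc L B) where
  toFun α := ⟨Con.map f α.1, Con.isCompactElement_map f α.2⟩
  map_sup' _ _ := Subtype.ext (Con.map_comap_gc f).l_sup
  map_bot' := Subtype.ext (Con.map_comap_gc f).l_bot

end Congruences

/-! ### Varieties of algebras and the functor `Conc` -/

/-- The algebra `A` satisfies the identity `e.1 = e.2` (for all values of the variables). -/
def Satisfies (L : FirstOrder.Language.{u, u}) (A : Type u) [L.Structure A] (e : L.Term ℕ × L.Term ℕ) : Prop :=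
  ∀ v : ℕ → A, e.1.realize v = e.2.realize v

/-- The variety of `L`-algebras defined by the set `E` of identities: its members are the nonempty
`L`-algebras satisfying all identities in `E`. -/
structure Variety (L : FirstOrder.Language.{u, u}) (E : Set (L.Term ℕ × L.Term ℕ)) where
  /-- The underlying set of the algebra. -/
  carrier : Type u
  [str : L.Structure carrier]
  [nonempty : Nonempty carrier]
  satisfies : ∀ e ∈ E, Satisfies L carrier e

attribute [instance] Variety.str

/-- The morphisms of a variety are all homomorphisms between its members. -/
instance (L : FirstOrder.Language.{u, u}) (E : Set (L.Term ℕ × L.Term ℕ)) : Category.{u} (Variety L E) where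
  Hom A B := A.carrier →[L] B.carrier
  id A := FirstOrder.Language.Hom.id L A.carrier
  comp f g := g.comp f

/-- The functor `Conc` from a variety to the category of `(∨,0)`-semilattices. -/
def concFunctor (L : FirstOrder.Language.{u, u}) (E : Set (L.Term ℕ × L.Term ℕ)) :
    Variety L E ⥤ SemilatSupCat.{u} where
  obj A := SemilatSupCat.of (Conc L A.carrier)
  map {A B} f := (Conc.map (f : A.carrier →[L] B.carrier) :
    SupBotHom (Conc L A.carrier) (Conc L B.carrier))
  map_id _ := SupBotHom.ext fun α => Subtype.ext (Con.map_id α.1)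
  map_comp f g := SupBotHom.ext fun α => Subtype.ext (Con.map_comp g f α.1)

/-- The semilattice `S` has a lifting in the variety: `Conc A ≅ S` for some member `A`. -/
def HasLifting (L : FirstOrder.Language.{u, u}) (E : Set (L.Term ℕ × L.Term ℕ)) (S : SemilatSupCat.{u}) :
    Prop :=
  ∃ A : Variety L E, Nonempty ((concFunctor L E).obj A ≅ S)

/-- The diagram `D` has a lifting in the variety: `Conc ∘ A` is naturally isomorphic to `D`
for some diagram `A` in the variety. -/
def DiagramHasLifting (L : FirstOrder.Language.{u, u}) (E : Set (L.Term ℕ × L.Term ℕ))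
    {P : Type u} [PartialOrder P] (D : P ⥤ SemilatSupCat.{u}) : Prop :=
  ∃ A : P ⥤ Variety L E, Nonempty (A ⋙ concFunctor L E ≅ D)

/-! ### Classes of semilattices

A class of `(∨,0)`-semilattices is a predicate on `SemilatSupCat`. A `(∨,0,1)`-semilattice is a
`(∨,0)`-semilattice with a largest element (which is then unique), so a class of
`(∨,0,1)`-semilattices is a class of `(∨,0)`-semilattices all of whose members have one. -/

/-- `X` belongs to the class up to isomorphism. -/
def IsoMem (𝒮 : SemilatSupCat.{u} → Prop) (X : SemilatSupCat.{u}) : Prop :=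
  ∃ Y, 𝒮 Y ∧ Nonempty (X ≅ Y)

/-- A `(∨,0)`-subsemilattice. -/
structure SubSemilat (X : SemilatSupCat.{u}) where
  /-- The underlying subset. -/
  carrier : Set X
  bot_mem : ⊥ ∈ carrier
  sup_mem : ∀ {x y : X}, x ∈ carrier → y ∈ carrier → x ⊔ y ∈ carrier

/-- A `(∨,0)`-subsemilattice, as a `(∨,0)`-semilattice. -/
def SubSemilat.toCat {X : SemilatSupCat.{u}} (B : SubSemilat X) : SemilatSupCat.{u} :=
  letI : SemilatticeSup {x : X // x ∈ B.carrier} := Subtype.semilatticeSup fun _ _ => B.sup_mem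
  letI : OrderBot {x : X // x ∈ B.carrier} := Subtype.orderBot B.bot_mem
  SemilatSupCat.of {x : X // x ∈ B.carrier}

/-- `X` is the directed union of the nonempty upward directed set `K` of subsemilattices. -/
structure IsDirectedUnion (X : SemilatSupCat.{u}) (K : Set (SubSemilat X)) : Prop where
  nonempty : K.Nonempty
  directed : DirectedOn (fun B C => B.carrier ⊆ C.carrier) K
  cover : ∀ x : X, ∃ B ∈ K, x ∈ B.carrier

/-- The class is closed, up to isomorphism, under (nonempty) finite direct products. -/
def ClosedUnderFiniteProducts (𝒮 : SemilatSupCat.{u} → Prop) : Prop :=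
  ∀ (ι : Type) [Finite ι] [Nonempty ι] (X : ι → SemilatSupCat.{u}), (∀ i, 𝒮 (X i)) →
    IsoMem 𝒮 (SemilatSupCat.of (∀ i, X i))

/-- The class is closed, up to isomorphism, under directed unions. -/
def ClosedUnderDirectedUnions (𝒮 : SemilatSupCat.{u} → Prop) : Prop :=
  ∀ (X : SemilatSupCat.{u}) (K : Set (SubSemilat X)), IsDirectedUnion X K →
    (∀ B ∈ K, IsoMem 𝒮 B.toCat) → IsoMem 𝒮 X

/-- The class is closed, up to isomorphism, under directed unions preserving `0` and `1`: all
the subsemilattices contain the largest element of the union. -/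
def ClosedUnderDirectedUnionsWithTop (𝒮 : SemilatSupCat.{u} → Prop) : Prop :=
  ∀ (X : SemilatSupCat.{u}) (K : Set (SubSemilat X)), IsDirectedUnion X K →
    (∃ t : X, IsTop t ∧ ∀ B ∈ K, t ∈ B.carrier) →
    (∀ B ∈ K, IsoMem 𝒮 B.toCat) → IsoMem 𝒮 X

/-- All arrows of the diagram send the largest element of their domain (if it exists) to the
largest element of their codomain. -/
def PreservesTop {P : Type u} [PartialOrder P] (D : P ⥤ SemilatSupCat.{u}) : Prop :=
  ∀ ⦃p q : P⦄ (f : p ⟶ q) (t : D.obj p), IsTop t → IsTop (D.map f t)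

/-! ### Trees -/

/-- A well-founded tree: a poset with a smallest element all of whose principal lower subsets are
well-founded chains. -/
structure IsWellFoundedTree (T : Type u) [PartialOrder T] : Prop where
  exists_bot : ∃ b : T, IsBot b
  isChain : ∀ t : T, IsChain (· ≤ ·) (Set.Iic t)
  isWF : ∀ t : T, (Set.Iic t).IsWF

/-- `P` is (isomorphic to) a finite product of well-founded trees, ordered componentwise. -/
def IsFiniteProductOfWellFoundedTrees (P : Type u) [PartialOrder P] : Prop :=
  ∃ (n : ℕ) (T : Fin n → Type u) (_ : ∀ k, PartialOrder (T k)),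
    (∀ k, IsWellFoundedTree (T k)) ∧ Nonempty (P ≃o ∀ k, T k)

end CongLift

namespace CongLift

/-! ### Free sections over products of trees -/

open Cardinal

/-! The diagram `D` is cut out of a lifting of one large semilattice. Given an isotone `d : X → P`,
pull `D` back to `X`; the condensate consists of the families in the product of all `D (d x)` that
are determined by their values on a finite set. It is a directed union of finite products, hence
lies in the class and is isomorphic to `Conc A` for a single algebra `A`. Its projections give maps
`ρ x` from `Conc A` onto `D (d x)` that behave like quotients by ideals.

A Löwenheim–Skolem closure (`exists_closure_operator`, `exists_monotone_closure_mk_le`) yields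
subalgebras `B x` of size at most `κ`, increasing in `x`, on which `ρ x` keeps these properties;
then `B x` modulo the kernel of `ρ x` lifts `D (d x)`. Along a section `σ` of `d` these quotients
form a lifting of `D` provided that, for `p ≤ q` and a pair from `B (σ p)`, the value of its
principal congruence at `σ q` is the image of its value at `σ p`. By `IsSupportedBy.map_eq` this
holds if no element of the finite support is below `σ q` without being below `σ p`. Only `κ`
supports arise at each point, so the question is purely combinatorial: find `X` with sections
avoiding `κ` finite sets per point. `HasFreeSections.prod_tree` does this one tree factor at a time,
by well-founded recursion with more labels than there are obstacles. -/

/-- For every large enough `κ`, there are a poset `X` over `P` and a cofinal family `𝓕` of finite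
subsets of `X` onto which `X` retracts, such that for all choices of at most `κ` members of `𝓕` at
each point of `X` there is an isotone section `σ` of `X` over `P` for which every `F` chosen
at `σ p` satisfies `F ∩ Iic (σ q) ⊆ Iic (σ p)` whenever `p ≤ q`. -/
def HasFreeSections (P : Type u) [PartialOrder P] : Prop :=
  ∀ κ : Cardinal.{u}, ℵ₀ ≤ κ → #P ≤ κ →
    ∃ (X : Type u) (_ : PartialOrder X) (d : X →o P) (𝓕 : Set (Finset X)),
      (∀ x : X, #(Set.Iic x) ≤ κ) ∧
      (∀ F ∈ 𝓕, ∀ x : X, ∃ f, IsGreatest {y | y ∈ F ∧ y ≤ x} f) ∧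
      (∀ F : Finset X, ∃ F' ∈ 𝓕, F ⊆ F') ∧
      ∀ G : X → Set (Finset X), (∀ x, G x ⊆ 𝓕) → (∀ x, #(G x) ≤ κ) →
        ∃ σ : P →o X, (∀ p, d (σ p) = p) ∧
          ∀ p q, p ≤ q → ∀ F ∈ G (σ p), ∀ z ∈ F, z ≤ σ q → z ≤ σ p

theorem hasFreeSections_of_unique (P : Type u) [PartialOrder P] [Unique P] :
    HasFreeSections P := by
  intro κ hκ hP
  refine ⟨P, inferInstance, OrderHom.id, {F | default ∈ F}, fun x => ?_, fun F hF x => ?_,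
    fun F => ?_, fun G _ _ => ?_⟩
  · exact (mk_set_le _).trans hP
  · exact ⟨default, ⟨hF, (Subsingleton.elim _ _).le⟩, fun y _ => (Subsingleton.elim _ _).le⟩
  · exact ⟨{default}, by simp, fun x _ => by simp [Subsingleton.elim x default]⟩
  · exact ⟨OrderHom.id, fun _ => rfl, fun p q _ F _ z _ _ => (Subsingleton.elim _ _).le⟩

theorem HasFreeSections.congr {P Q : Type u} [PartialOrder P] [PartialOrder Q] (e : P ≃o Q)
    (h : HasFreeSections P) : HasFreeSections Q := by
  intro κ hκ hQ
  obtain ⟨X, _, d, 𝓕, h₁, h₂, h₃, h₄⟩ := h κ hκ ((mk_congr e.toEquiv).le.trans hQ)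
  refine ⟨X, _, (e : P →o Q).comp d, 𝓕, h₁, h₂, h₃, fun G hG hG' => ?_⟩
  obtain ⟨σ, hσ, hσ'⟩ := h₄ G hG hG'
  refine ⟨σ.comp (e.symm : Q →o P), fun q => ?_, fun p q hpq F hF z hz hzq => ?_⟩
  · simp [hσ]
  · exact hσ' _ _ (e.symm.monotone hpq) F hF z hz hzq

/-! ### Labelled trees and the choice of labels by recursion. -/

theorem exists_forall_notMem_of_wellFounded {T Ω : Type u} {r : T → T → Prop}
    (hr : WellFounded r) (V : ∀ t, (∀ s, r s t → Ω) → Set Ω) (hV : ∀ t g, ∃ ω, ω ∉ V t g) :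
    ∃ c : T → Ω, ∀ t, c t ∉ V t (fun s _ => c s) := by
  refine ⟨hr.fix fun t g => (hV t g).choose, fun t => ?_⟩
  rw [WellFounded.fix_eq]
  exact (hV t _).choose_spec

theorem IsWellFoundedTree.wellFounded_lt {T : Type u} [PartialOrder T]
    (hT : IsWellFoundedTree T) : WellFounded ((· < ·) : T → T → Prop) := by
  refine WellFounded.wellFounded_iff_has_min.2 fun s ⟨t, ht⟩ => ?_
  obtain ⟨m, hm, hmin⟩ := (hT.isWF t).has_min {x | x.1 ∈ s} ⟨⟨t, le_rfl⟩, ht⟩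
  exact ⟨m, hm, fun x hx hxm => hmin ⟨x, hxm.le.trans m.2⟩ hx hxm⟩

theorem mk_iUnion_le_of_le {ι α : Type u} {κ : Cardinal.{u}} (hκ : ℵ₀ ≤ κ) (hι : #ι ≤ κ)
    {f : ι → Set α} (hf : ∀ i, #(f i) ≤ κ) : #(⋃ i, f i) ≤ κ :=
  (mk_iUnion_le f).trans (mul_le_of_le hκ hι (ciSup_le' hf))

/-- The tree of all pairs `(t, f)`, where `f` labels by elements of `Ω` all elements of the tree `T`
(with root `b`) that are below `t`, except the root. -/
structure LabelTree (T Ω : Type u) [PartialOrder T] (b : T) where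
  /-- The length of the labelling. -/
  top : T
  /-- The labels. -/
  label : Set.Ioc b top → Ω

namespace LabelTree

variable {T Ω : Type u} [PartialOrder T] {b : T}

instance : PartialOrder (LabelTree T Ω b) where
  le x y := ∃ h : x.top ≤ y.top, ∀ r : Set.Ioc b x.top, x.label r = y.label ⟨r, r.2.1, r.2.2.trans h⟩
  le_refl x := ⟨le_rfl, fun _ => rfl⟩
  le_trans x y z h₁ h₂ := ⟨h₁.1.trans h₂.1, fun r => (h₁.2 r).trans (h₂.2 _)⟩
  le_antisymm := by
    rintro ⟨s, f⟩ ⟨t, g⟩ h₁ h₂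
    obtain rfl : s = t := le_antisymm h₁.1 h₂.1
    congr 1
    funext r
    exact h₁.2 r

/-- The initial segment of a labelling of `T`. -/
def ofFun (c : T → Ω) (b t : T) : LabelTree T Ω b := ⟨t, fun r => c r⟩

theorem ofFun_mono (c : T → Ω) : Monotone (ofFun c b) :=
  fun _ _ h => ⟨h, fun _ => rfl⟩

theorem eq_ofFun_of_le {c : T → Ω} {t : T} {x : LabelTree T Ω b} (h : x ≤ ofFun c b t) :
    x = ofFun c b x.top := by
  obtain ⟨s, f⟩ := x
  unfold ofFun
  congr 1
  funext r
  exact h.2 r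

/-- The last label, or `ω` if there is none. -/
noncomputable def lastLabel (ω : Ω) (x : LabelTree T Ω b) : Ω :=
  open Classical in if h : b < x.top then x.label ⟨x.top, h, le_rfl⟩ else ω

theorem lastLabel_ofFun (ω : Ω) (c : T → Ω) {t : T} (h : b < t) :
    lastLabel ω (ofFun c b t) = c t := by
  unfold lastLabel
  rw [dif_pos (show b < (ofFun c b t).top from h)]
  rfl

theorem mk_Iic_le (x : LabelTree T Ω b) : #(Set.Iic x) ≤ #T := by
  refine mk_le_of_injective (f := fun y : Set.Iic x => y.1.top) ?_
  rintro ⟨⟨s, f⟩, hf⟩ ⟨⟨t, g⟩, hg⟩ h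
  obtain rfl : s = t := h
  congr 2
  funext r
  exact (hf.2 r).trans (hg.2 r).symm

theorem isChain_Iic (hT : ∀ t : T, IsChain (· ≤ ·) (Set.Iic t)) (x : LabelTree T Ω b) :
    IsChain (· ≤ ·) (Set.Iic x) := by
  intro y hy z hz _
  rcases (hT x.top).total hy.1 hz.1 with h | h
  · exact Or.inl ⟨h, fun r => (hy.2 r).trans (hz.2 ⟨r, r.2.1, r.2.2.trans h⟩).symm⟩
  · exact Or.inr ⟨h, fun r => (hz.2 r).trans (hy.2 ⟨r, r.2.1, r.2.2.trans h⟩).symm⟩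

/-- The root of the tree of labellings. -/
def root (b : T) : LabelTree T Ω b := ⟨b, fun r => absurd r.2.1 r.2.2.not_gt⟩

theorem root_le (hb : IsBot b) (x : LabelTree T Ω b) : root b ≤ x :=
  ⟨hb _, fun r => absurd r.2.1 r.2.2.not_gt⟩

end LabelTree

theorem exists_isGreatest_of_isChain_Iic {X : Type u} [PartialOrder X]
    (hX : ∀ x : X, IsChain (· ≤ ·) (Set.Iic x)) {b : X} (hb : IsBot b) {F : Finset X}
    (hF : b ∈ F) (x : X) : ∃ f, IsGreatest {y | y ∈ F ∧ y ≤ x} f := by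
  have hfin : {y | y ∈ F ∧ y ≤ x}.Finite := F.finite_toSet.subset fun y hy => hy.1
  obtain ⟨m, hm⟩ := hfin.exists_maximal ⟨b, hF, hb x⟩
  refine ⟨m, hm.prop, fun y hy => ?_⟩
  rcases (hX x).total hy.2 hm.prop.2 with h | h
  · exact h
  · exact hm.le_of_ge hy h

/-- A labelling `c` of `T` gives the section `t ↦ ofFun c b t` of the label tree. Each `c t` is
chosen to differ from the last label of every point in a finite set chosen over `ofFun c b s`, `s <
t`. A point of such a set that lies on the branch of `c` strictly above `s` would end in exactly
such a label, so there is none. This settles the `T`-coordinate; with `c` fixed, the hypothesis on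
`P` settles the other one. -/
theorem HasFreeSections.prod_tree {P T : Type u} [PartialOrder P] [PartialOrder T] [Nonempty P]
    (hP : HasFreeSections P) (hT : IsWellFoundedTree T) : HasFreeSections (P × T) := by
  classical
  intro κ hκ hκ'
  obtain ⟨b, hb⟩ := hT.exists_bot
  have hwf := hT.wellFounded_lt
  obtain ⟨p₀⟩ := ‹Nonempty P›
  have hκP : #P ≤ κ := (mk_le_of_injective (f := fun p => (p, b)) fun _ _ h =>
    congrArg Prod.fst h).trans hκ'
  have hκT : #T ≤ κ := (mk_le_of_injective (f := fun t => (p₀, t)) fun _ _ h =>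
    congrArg Prod.snd h).trans hκ'
  obtain ⟨X, _, d, 𝓕, h₁, h₂, h₃, h₄⟩ := hP κ hκ hκP
  -- The labels are chosen before the section into `X` is known, so they must avoid obstacles over
  -- all of `X`; hence more than `max κ #X` of them.
  let Ω : Type u := (Order.succ (max κ #X)).out
  have hΩ : max κ #X < #Ω := by
    rw [mk_out]; exact Order.lt_succ _
  obtain ⟨ω₀⟩ : Nonempty Ω :=
    mk_ne_zero_iff.1 (bot_le.trans_lt hΩ).ne'
  let Y := LabelTree T Ω b
  refine ⟨X × Y, inferInstance,
    ⟨fun x => (d x.1, x.2.top), fun x y h => ⟨d.monotone h.1, h.2.1⟩⟩,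
    -- The root in `F₂` ensures that something in `F₂` lies below each point, and also that the
    -- first projection of `F₁ ×ˢ F₂` is `F₁`, a member of `𝓕`.
    {F | ∃ F₁ ∈ 𝓕, ∃ F₂ : Finset Y, LabelTree.root b ∈ F₂ ∧ F = F₁ ×ˢ F₂}, ?_, ?_, ?_, ?_⟩
  · intro x
    rw [← Set.Iic_prod_Iic, mk_setProd]
    exact mul_le_of_le hκ (h₁ _) ((LabelTree.mk_Iic_le _).trans hκT)
  · rintro _ ⟨F₁, hF₁, F₂, hF₂, rfl⟩ x
    obtain ⟨f₁, hf₁⟩ := h₂ F₁ hF₁ x.1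
    obtain ⟨f₂, hf₂⟩ := exists_isGreatest_of_isChain_Iic
      (LabelTree.isChain_Iic hT.isChain) (LabelTree.root_le hb) hF₂ x.2
    refine ⟨(f₁, f₂), ⟨Finset.mk_mem_product hf₁.1.1 hf₂.1.1, hf₁.1.2, hf₂.1.2⟩, ?_⟩
    rintro y ⟨hy, hyx⟩
    rw [Finset.mem_product] at hy
    exact ⟨hf₁.2 ⟨hy.1, hyx.1⟩, hf₂.2 ⟨hy.2, hyx.2⟩⟩
  · intro F
    obtain ⟨F₁, hF₁, h⟩ := h₃ (F.image Prod.fst)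
    refine ⟨_, ⟨F₁, hF₁, insert (LabelTree.root b) (F.image Prod.snd), by simp, rfl⟩,
      fun x hx => Finset.mem_product.2 ⟨h (Finset.mem_image_of_mem _ hx), ?_⟩⟩
    exact Finset.mem_insert_of_mem (Finset.mem_image_of_mem _ hx)
  · intro G hG hG'
    let V : ∀ t : T, (∀ s, s < t → Ω) → Set Ω := fun t g =>
      ⋃ i : X × {s // s < t}, ⋃ F : G (i.1, ⟨i.2, fun r => g r (r.2.2.trans_lt i.2.2)⟩),
        (fun z : X × Y => z.2.lastLabel ω₀) '' F.1
    have hV : ∀ t g, ∃ ω, ω ∉ V t g := by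
      intro t g
      by_contra! h
      rw [← mk_univ (α := Ω), ← Set.eq_univ_of_forall h] at hΩ
      refine hΩ.not_ge ?_
      have hμ : ℵ₀ ≤ max κ #X := hκ.trans (le_max_left _ _)
      refine mk_iUnion_le_of_le hμ ?_ fun i => mk_iUnion_le_of_le hμ ?_ fun F => ?_
      · rw [mk_prod, lift_id, lift_id]
        refine mul_le_of_le hμ (le_max_right _ _) ?_
        exact ((mk_set_le _).trans hκT).trans (le_max_left _ _)
      · exact (hG' _).trans (le_max_left _ _)
      · exact ((F.1.finite_toSet.image _).lt_aleph0.le).trans hμ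
    obtain ⟨c, hc⟩ := exists_forall_notMem_of_wellFounded hwf V hV
    -- All `t` are treated at once, since `σ` must depend on the `P`-coordinate only; there are at
    -- most `κ` of them.
    let G₁ : X → Set (Finset X) := fun x =>
      ⋃ t : T, (fun F : Finset (X × Y) => F.image Prod.fst) '' G (x, LabelTree.ofFun c b t)
    have key : ∀ x t q, t ≤ q → ∀ F ∈ G (x, LabelTree.ofFun c b t), ∀ z ∈ F,
        z.2 ≤ LabelTree.ofFun c b q → z.2 ≤ LabelTree.ofFun c b t := by
      intro x t q htq F hF z hz hzq
      rw [LabelTree.eq_ofFun_of_le hzq]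
      apply LabelTree.ofFun_mono
      by_contra hcon
      have hlt : t < z.2.top :=
        lt_of_le_of_ne (((hT.isChain q).total hzq.1 htq).resolve_left hcon) fun h => hcon h.ge
      refine hc z.2.top (Set.mem_iUnion.2 ⟨(x, ⟨t, hlt⟩), Set.mem_iUnion.2 ⟨⟨F, hF⟩, z, hz, ?_⟩⟩)
      dsimp only
      rw [LabelTree.eq_ofFun_of_le hzq]
      exact LabelTree.lastLabel_ofFun _ _ ((hb t).trans_lt hlt)
    have hG₁ : ∀ x, G₁ x ⊆ 𝓕 := by
      intro x _ hF'
      obtain ⟨t, F, hF, rfl⟩ := Set.mem_iUnion.1 hF'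
      obtain ⟨F₁, hF₁, F₂, hF₂, rfl⟩ := hG _ hF
      dsimp only
      rwa [Finset.product_image_fst ⟨_, hF₂⟩]
    have hG₁' : ∀ x, #(G₁ x) ≤ κ := by
      intro x
      refine (mk_iUnion_le_of_le hκ hκT fun t => ?_)
      exact mk_image_le.trans (hG' _)
    obtain ⟨σ, hσ, hσ'⟩ := h₄ G₁ hG₁ hG₁'
    refine ⟨⟨fun p => (σ p.1, LabelTree.ofFun c b p.2), fun p q h =>
      ⟨σ.monotone h.1, LabelTree.ofFun_mono c h.2⟩⟩, fun p => Prod.ext (hσ _) rfl,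
      fun p q hpq F hF z hz hzq => ⟨?_, key _ _ _ hpq.2 F hF z hz hzq.2⟩⟩
    exact hσ' p.1 q.1 hpq.1 (F.image Prod.fst) (Set.mem_iUnion.2 ⟨p.2, F, hF, rfl⟩) z.1
      (Finset.mem_image_of_mem _ hz) hzq.1

theorem hasFreeSections_pi (n : ℕ) (T : Fin n → Type u) [∀ k, PartialOrder (T k)]
    (hT : ∀ k, IsWellFoundedTree (T k)) : HasFreeSections (∀ k, T k) := by
  induction n with
  | zero => exact hasFreeSections_of_unique _
  | succ n ih =>
    have (k : Fin n) : Nonempty (T k.succ) := ⟨(hT _).exists_bot.choose⟩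
    exact ((ih (fun k => T k.succ) fun k => hT _).prod_tree (hT 0)).congr
      (OrderIso.prodComm.trans (Fin.consOrderIso T))

theorem IsFiniteProductOfWellFoundedTrees.hasFreeSections {P : Type u} [PartialOrder P]
    (hP : IsFiniteProductOfWellFoundedTrees P) : HasFreeSections P := by
  obtain ⟨n, T, _, hT, ⟨e⟩⟩ := hP
  exact (hasFreeSections_pi n T hT).congr e.symm

/-! ### Condensates -/

section Condensate

variable {X : Type u} [PartialOrder X] (S : X ⥤ SemilatSupCat.{u})

/-- The family `s` is determined by its restriction to `F`: if `f` is the greatest element of `F`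
below `x`, then `s x` is the image of `s f`. -/
def IsSupportedBy (F : Finset X) (s : ∀ x, S.obj x) : Prop :=
  ∀ x f (hx : f ≤ x), IsGreatest {y | y ∈ F ∧ y ≤ x} f → s x = S.map (homOfLE hx) (s f)

variable {S} in
theorem IsSupportedBy.sup {F : Finset X} {s t : ∀ x, S.obj x} (hs : IsSupportedBy S F s)
    (ht : IsSupportedBy S F t) : IsSupportedBy S F (s ⊔ t) := fun x f hx hf => by
  rw [Pi.sup_apply, Pi.sup_apply, map_sup, hs x f hx hf, ht x f hx hf]

theorem isSupportedBy_bot (F : Finset X) : IsSupportedBy S F ⊥ :=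
  fun _ _ hx _ => (map_bot (ConcreteCategory.hom (S.map (homOfLE hx)))).symm

/-- Every point of `X` has a greatest element of `F` below it. -/
def HasRetraction (F : Finset X) : Prop :=
  ∀ x : X, ∃ f, IsGreatest {y | y ∈ F ∧ y ≤ x} f

/-- A cofinal family of finite subsets onto which `X` retracts. -/
structure IsRetractionFamily (𝓕 : Set (Finset X)) : Prop where
  hasRetraction : ∀ F ∈ 𝓕, HasRetraction F
  cofinal : ∀ F : Finset X, ∃ F' ∈ 𝓕, F ⊆ F'

theorem map_homOfLE_trans {x y z : X} (h₁ : x ≤ y) (h₂ : y ≤ z) (a : S.obj x) :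
    S.map (homOfLE h₂) (S.map (homOfLE h₁) a) = S.map (homOfLE (h₁.trans h₂)) a := by
  rw [← homOfLE_comp h₁ h₂, S.map_comp]
  rfl

theorem map_homOfLE_refl {x : X} (h : x ≤ x) (a : S.obj x) : S.map (homOfLE h) a = a := by
  rw [Subsingleton.elim (homOfLE h) (𝟙 x), S.map_id]
  rfl

variable {S} in
theorem IsSupportedBy.mono {F F' : Finset X} {s : ∀ x, S.obj x} (hs : IsSupportedBy S F s)
    (hF : HasRetraction F) (h : F ⊆ F') : IsSupportedBy S F' s := by
  intro x f' hx hf'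
  obtain ⟨f, hf⟩ := hF x
  have hff' : f ≤ f' := hf'.2 ⟨h hf.1.1, hf.1.2⟩
  rw [hs x f hf.1.2 hf, hs f' f hff' ⟨⟨hf.1.1, hff'⟩, fun y hy => hf.2 ⟨hy.1, hy.2.trans hx⟩⟩,
    map_homOfLE_trans]

-- The greatest element of `F` below `y` is already below `x`, so both values are transported from
-- the same point. This turns freeness of a section into naturality.
variable {S} in
theorem IsSupportedBy.map_eq {F : Finset X} {s : ∀ x, S.obj x} (hs : IsSupportedBy S F s)
    (hF : HasRetraction F) {x y : X} (hxy : x ≤ y) (h : ∀ z ∈ F, z ≤ y → z ≤ x) :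
    S.map (homOfLE hxy) (s x) = s y := by
  obtain ⟨f, hf⟩ := hF y
  have hfx := h f hf.1.1 hf.1.2
  rw [hs y f hf.1.2 hf, hs x f hfx ⟨⟨hf.1.1, hfx⟩, fun z hz => hf.2 ⟨hz.1, hz.2.trans hxy⟩⟩,
    map_homOfLE_trans]

/-- The family supported by `F` with given restriction to `F`. -/
noncomputable def extend {F : Finset X} (hF : HasRetraction F) (v : ∀ f : F, S.obj f) (x : X) :
    S.obj x :=
  S.map (homOfLE (hF x).choose_spec.1.2) (v ⟨_, (hF x).choose_spec.1.1⟩)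

theorem extend_of_isGreatest {F : Finset X} (hF : HasRetraction F) (v : ∀ f : F, S.obj f) {x f : X}
    (hx : f ≤ x) (hf : IsGreatest {y | y ∈ F ∧ y ≤ x} f) :
    extend S hF v x = S.map (homOfLE hx) (v ⟨f, hf.1.1⟩) := by
  unfold extend
  have := (hF x).choose_spec.unique hf
  generalize_proofs h₁ h₂ h₃
  subst this
  rfl

theorem extend_apply {F : Finset X} (hF : HasRetraction F) (v : ∀ f : F, S.obj f) (f : F) :
    extend S hF v f = v f := by
  rw [extend_of_isGreatest S hF v (le_refl f.1) ⟨⟨f.2, le_rfl⟩, fun y hy => hy.2⟩,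
    map_homOfLE_refl]

theorem isSupportedBy_extend {F : Finset X} (hF : HasRetraction F) (v : ∀ f : F, S.obj f) :
    IsSupportedBy S F (extend S hF v) := fun x f hx hf => by
  rw [extend_of_isGreatest S hF v hx hf, ← extend_apply S hF v ⟨f, hf.1.1⟩]

variable {S} in
theorem IsSupportedBy.le_of_le {F : Finset X} {s t : ∀ x, S.obj x} (hs : IsSupportedBy S F s)
    (ht : IsSupportedBy S F t) (hF : HasRetraction F) (h : ∀ f ∈ F, s f ≤ t f) : s ≤ t := by
  intro x
  obtain ⟨f, hf⟩ := hF x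
  rw [hs x f hf.1.2 hf, ht x f hf.1.2 hf]
  exact OrderHomClass.mono (ConcreteCategory.hom (S.map (homOfLE hf.1.2))) (h f hf.1.1)

theorem IsRetractionFamily.exists_union {𝓕 : Set (Finset X)} (h𝓕 : IsRetractionFamily 𝓕)
    (F F' : Finset X) : ∃ G ∈ 𝓕, F ⊆ G ∧ F' ⊆ G := by
  classical
  obtain ⟨G, hG, h⟩ := h𝓕.cofinal (F ∪ F')
  exact ⟨G, hG, Finset.union_subset_iff.1 h⟩

variable {𝓕 : Set (Finset X)} (h𝓕 : IsRetractionFamily 𝓕)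

/-- All families supported by some member of `𝓕`. -/
def condensate : SubSemilat (SemilatSupCat.of (∀ x, S.obj x)) where
  carrier := {s | ∃ F ∈ 𝓕, IsSupportedBy S F s}
  bot_mem := by
    obtain ⟨F, hF, _⟩ := h𝓕.cofinal ∅
    exact ⟨F, hF, isSupportedBy_bot S F⟩
  sup_mem := by
    rintro s t ⟨F, hF, hs⟩ ⟨F', hF', ht⟩
    obtain ⟨G, hG, h, h'⟩ := h𝓕.exists_union F F'
    exact ⟨G, hG, (hs.mono (h𝓕.hasRetraction F hF) h).sup (ht.mono (h𝓕.hasRetraction F' hF') h')⟩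

/-- All families supported by `F`. -/
def condensateLayer (F : Finset X) : SubSemilat (condensate S h𝓕).toCat where
  carrier := {s | IsSupportedBy S F s.1}
  bot_mem := isSupportedBy_bot S F
  sup_mem hs ht := IsSupportedBy.sup hs ht

theorem isDirectedUnion_condensate :
    IsDirectedUnion (condensate S h𝓕).toCat (condensateLayer S h𝓕 '' 𝓕) where
  nonempty := by
    obtain ⟨F, hF, _⟩ := h𝓕.cofinal ∅
    exact ⟨_, F, hF, rfl⟩
  directed := by
    rintro _ ⟨F, hF, rfl⟩ _ ⟨F', hF', rfl⟩
    obtain ⟨G, hG, h, h'⟩ := h𝓕.exists_union F F'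
    exact ⟨_, ⟨G, hG, rfl⟩, fun s hs => IsSupportedBy.mono hs (h𝓕.hasRetraction F hF) h,
      fun s hs => IsSupportedBy.mono hs (h𝓕.hasRetraction F' hF') h'⟩
  cover := by
    rintro ⟨s, F, hF, hs⟩
    exact ⟨_, ⟨F, hF, rfl⟩, hs⟩

/-- A family supported by `F` is the same as a family indexed by `F`. -/
noncomputable def condensateLayerIso {F : Finset X} (hF : F ∈ 𝓕) {n : ℕ} (e : Fin n ≃ F) :
    (condensateLayer S h𝓕 F).toCat ≃o ∀ i, S.obj (e i) where
  toFun s i := s.1.1 (e i)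
  invFun v :=
    ⟨⟨extend S (h𝓕.hasRetraction F hF) (e.piCongrLeft (fun f : F => S.obj f) v), F, hF,
        isSupportedBy_extend S _ _⟩,
      isSupportedBy_extend S _ _⟩
  left_inv s := by
    refine Subtype.ext (Subtype.ext ?_)
    have h := isSupportedBy_extend S (h𝓕.hasRetraction F hF)
      (e.piCongrLeft (fun f : F => S.obj f) fun i => s.1.1 (e i))
    have key (f : F) : extend S (h𝓕.hasRetraction F hF)
        (e.piCongrLeft (fun f : F => S.obj f) fun i => s.1.1 (e i)) f = s.1.1 f := by
      rw [extend_apply]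
      obtain ⟨i, rfl⟩ := e.surjective f
      exact Equiv.piCongrLeft_apply_apply _ _ _ _
    exact le_antisymm
      (h.le_of_le s.2 (h𝓕.hasRetraction F hF) fun f hf => (key ⟨f, hf⟩).le)
      (IsSupportedBy.le_of_le s.2 h (h𝓕.hasRetraction F hF) fun f hf => (key ⟨f, hf⟩).ge)
  right_inv v := by
    funext i
    exact (extend_apply S _ _ _).trans (Equiv.piCongrLeft_apply_apply _ _ _ _)
  map_rel_iff' {s t} := by
    refine ⟨fun h => ?_, fun h i => h (e i)⟩
    refine IsSupportedBy.le_of_le s.2 t.2 (h𝓕.hasRetraction F hF) fun f hf => ?_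
    obtain ⟨i, hi⟩ := e.surjective ⟨f, hf⟩
    have key (g : F) (hg : e i = g) : s.1.1 g ≤ t.1.1 g := hg ▸ h i
    exact key _ hi

/-! ### Membership of condensates in the class, and their projections. -/

variable (𝒮 : SemilatSupCat.{u} → Prop)

theorem isoMem_condensateLayer (h𝒮 : ClosedUnderFiniteProducts 𝒮) (hS : ∀ x, 𝒮 (S.obj x))
    [Nonempty X] {F : Finset X} (hF : F ∈ 𝓕) : IsoMem 𝒮 (condensateLayer S h𝓕 F).toCat := by
  -- A retraction defined on a nonempty `X` forces `F` to be nonempty, as closure under products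
  -- requires.
  obtain ⟨f, hf⟩ := h𝓕.hasRetraction F hF (Classical.arbitrary X)
  let e : Fin F.card ≃ F := F.equivFin.symm
  have : Nonempty (Fin F.card) := ⟨e.symm ⟨f, hf.1.1⟩⟩
  obtain ⟨Y, hY, ⟨i⟩⟩ := h𝒮 (Fin F.card) (fun i => S.obj (e i)) fun i => hS _
  let j : _ ≅ SemilatSupCat.of (∀ i, S.obj (e i)) :=
    SemilatSupCat.Iso.mk (condensateLayerIso S h𝓕 hF e)
  exact ⟨Y, hY, ⟨j.trans i⟩⟩

theorem isoMem_condensate (h𝒮 : ClosedUnderFiniteProducts 𝒮) (h𝒮' : ClosedUnderDirectedUnions 𝒮)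
    (hS : ∀ x, 𝒮 (S.obj x)) [Nonempty X] : IsoMem 𝒮 (condensate S h𝓕).toCat := by
  refine h𝒮' _ _ (isDirectedUnion_condensate S h𝓕) ?_
  rintro _ ⟨F, hF, rfl⟩
  exact isoMem_condensateLayer S h𝓕 𝒮 h𝒮 hS hF

theorem isoMem_condensate_of_preservesTop (h𝒮 : ClosedUnderFiniteProducts 𝒮)
    (h𝒮' : ClosedUnderDirectedUnionsWithTop 𝒮) (htop : ∀ Y, 𝒮 Y → ∃ t : Y, IsTop t)
    (hS : ∀ x, 𝒮 (S.obj x)) (hS' : PreservesTop S) [Nonempty X] :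
    IsoMem 𝒮 (condensate S h𝓕).toCat := by
  choose t ht using fun x => htop _ (hS x)
  -- Since arrows preserve the top, the family of tops is supported by every finite set, hence lies
  -- in every layer.
  have htF (F : Finset X) : IsSupportedBy S F t := fun x f hx _ =>
    le_antisymm (hS' _ _ (ht f) _) (ht x _)
  refine h𝒮' _ _ (isDirectedUnion_condensate S h𝓕) ?_ ?_
  · obtain ⟨F, hF, _⟩ := h𝓕.cofinal ∅
    refine ⟨⟨t, F, hF, htF F⟩, fun s x => ht x _, ?_⟩
    rintro _ ⟨F, hF, rfl⟩
    exact htF F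
  · rintro _ ⟨F, hF, rfl⟩
    exact isoMem_condensateLayer S h𝓕 𝒮 h𝒮 hS hF

/-- The projections of a condensate. -/
def condensateProj (x : X) : SupBotHom (condensate S h𝓕).toCat (S.obj x) where
  toFun s := s.1 x
  map_sup' _ _ := rfl
  map_bot' := rfl

theorem condensateProj_surjective (x : X) : Function.Surjective (condensateProj S h𝓕 x) := by
  classical
  intro a
  obtain ⟨F, hF, h⟩ := h𝓕.cofinal {x}
  have hx : x ∈ F := h (Finset.mem_singleton_self x)
  let v (f : F) : S.obj f := Function.update (β := fun x => S.obj x) ⊥ x a f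
  refine ⟨⟨_, F, hF, isSupportedBy_extend S (h𝓕.hasRetraction F hF) v⟩, ?_⟩
  exact (extend_apply S _ v ⟨x, hx⟩).trans (Function.update_self (β := fun x => S.obj x) x a _)

/-- On a support containing `x` the coordinates are independent: let `u` be `⊥` at `x` and agree
with `s` elsewhere. So the projection is the quotient by the ideal of elements that it kills. -/
theorem exists_le_sup_of_condensateProj_le (x : X) (s t : (condensate S h𝓕).toCat)
    (h : condensateProj S h𝓕 x s ≤ condensateProj S h𝓕 x t) :
    ∃ u, condensateProj S h𝓕 x u = ⊥ ∧ s ≤ t ⊔ u := by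
  classical
  obtain ⟨s, F, hF, hs⟩ := s
  obtain ⟨t, F', hF', ht⟩ := t
  obtain ⟨F₁, hF₁, h₁, h₂⟩ := h𝓕.exists_union F F'
  obtain ⟨G, hG, h₃, h₄⟩ := h𝓕.exists_union F₁ {x}
  replace hs := hs.mono (h𝓕.hasRetraction F hF) (h₁.trans h₃)
  replace ht := ht.mono (h𝓕.hasRetraction F' hF') (h₂.trans h₃)
  have hx : x ∈ G := h₄ (Finset.mem_singleton_self x)
  let v (f : G) : S.obj f := Function.update (β := fun x => S.obj x) s x ⊥ f
  have hu := isSupportedBy_extend S (h𝓕.hasRetraction G hG) v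
  refine ⟨⟨_, G, hG, hu⟩, ?_, ?_⟩
  · exact (extend_apply S _ v ⟨x, hx⟩).trans (Function.update_self x ⊥ _)
  · refine hs.le_of_le (ht.sup hu) (h𝓕.hasRetraction G hG) fun f hf => ?_
    change s f ≤ t f ⊔ extend S (h𝓕.hasRetraction G hG) v f
    rw [extend_apply S (h𝓕.hasRetraction G hG) v ⟨f, hf⟩]
    rcases eq_or_ne f x with rfl | hne
    · exact le_sup_of_le_left h
    · exact le_sup_of_le_right (Function.update_of_ne hne _ _).ge

end Condensate

/-! ### Compact congruences as finite joins of principal congruences -/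

section Principal

variable {L : FirstOrder.Language.{u, u}} {A B C : Type u} [L.Structure A] [L.Structure B]
  [L.Structure C]

theorem Con.rel_of_eq (θ : Con L A) {a b : A} (h : a = b) : θ.rel a b := h ▸ θ.equiv.refl a

/-- The congruence generated by one pair. -/
def Con.principal (a b : A) : Con L A := Con.gen fun x y => x = a ∧ y = b

theorem Con.principal_le {a b : A} {θ : Con L A} : Con.principal a b ≤ θ ↔ θ.rel a b := by
  rw [Con.principal, Con.gen_le]
  exact ⟨fun h => h a b ⟨rfl, rfl⟩, by rintro h _ _ ⟨rfl, rfl⟩; exact h⟩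

theorem Con.isCompactElement_principal (a b : A) :
    IsCompactElement (Con.principal a b : Con L A) := by
  rw [CompleteLattice.isCompactElement_iff_le_of_directed_sSup_le]
  intro S hne hdir h
  obtain ⟨α, hα, hab⟩ := Con.sSup_rel_of_directedOn hne hdir (Con.principal_le.1 h)
  exact ⟨α, hα, Con.principal_le.2 hab⟩

/-- The compact congruence generated by one pair. -/
def Conc.principal (a b : A) : Conc L A := ⟨Con.principal a b, Con.isCompactElement_principal a b⟩

theorem Conc.principal_le {a b : A} {θ : Conc L A} : Conc.principal a b ≤ θ ↔ θ.1.rel a b :=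
  Con.principal_le

theorem Conc.coe_finset_sup {ι : Type*} (t : Finset ι) (f : ι → Conc L A) :
    (t.sup f).1 = t.sup fun i => (f i).1 :=
  Finset.apply_sup_eq_sup_comp (fun α : Conc L A => α.1) (fun _ _ => rfl) rfl

theorem Conc.exists_eq_sup_principal (α : Conc L A) :
    ∃ t : Finset (A × A), α = t.sup fun p => Conc.principal p.1 p.2 := by
  classical
  obtain ⟨t, ht⟩ := (CompleteLattice.isCompactElement_iff_exists_le_iSup_of_le_iSup α.1).1 α.2
    {p : A × A // α.1.rel p.1 p.2} (fun p => Con.principal p.1.1 p.1.2) (by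
      intro a b hab
      exact Con.principal_le.1 (le_iSup (fun p : {p : A × A // α.1.rel p.1 p.2} =>
        (Con.principal p.1.1 p.1.2 : Con L A)) ⟨(a, b), hab⟩))
  refine ⟨t.image Subtype.val, le_antisymm ?_ ?_⟩
  · change α.1 ≤ _
    rw [Conc.coe_finset_sup, Finset.sup_image]
    exact ht
  · refine Finset.sup_le fun p hp => ?_
    obtain ⟨p, _, rfl⟩ := Finset.mem_image.1 hp
    exact Conc.principal_le.2 p.2

theorem Conc.map_principal (f : A →[L] B) (a b : A) :
    Conc.map f (Conc.principal a b) = Conc.principal (f a) (f b) := by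
  refine Subtype.ext (eq_of_forall_ge_iff fun θ => ?_)
  exact ((Con.map_comap_gc f) _ _).trans
    (Con.principal_le.trans (Con.principal_le (a := f a) (b := f b)).symm)

theorem Conc.hom_ext {M : Type*} [SemilatticeSup M] [OrderBot M] {f g : SupBotHom (Conc L A) M}
    (h : ∀ a b, f (Conc.principal a b) = g (Conc.principal a b)) : f = g := by
  ext α
  obtain ⟨t, rfl⟩ := Conc.exists_eq_sup_principal α
  rw [map_finset_sup, map_finset_sup]
  exact Finset.sup_congr rfl fun p _ => h p.1 p.2

theorem Conc.exists_map_eq_sup_principal (f : A →[L] B) (t : Finset (B × B))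
    (ht : ∀ p ∈ t, p.1 ∈ Set.range f ∧ p.2 ∈ Set.range f) :
    ∃ α, Conc.map f α = t.sup fun p => Conc.principal p.1 p.2 := by
  classical
  induction t using Finset.induction_on with
  | empty => exact ⟨⊥, map_bot _⟩
  | insert p t _ ih =>
    obtain ⟨α, hα⟩ := ih fun q hq => ht q (Finset.mem_insert_of_mem hq)
    obtain ⟨⟨a, ha⟩, b, hb⟩ := ht p (Finset.mem_insert_self p t)
    refine ⟨Conc.principal a b ⊔ α, ?_⟩
    rw [map_sup, hα, Conc.map_principal, ha, hb, Finset.sup_insert]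

theorem Conc.map_surjective {f : A →[L] B} (hf : Function.Surjective f) :
    Function.Surjective (Conc.map f) := by
  intro β
  obtain ⟨t, rfl⟩ := Conc.exists_eq_sup_principal β
  exact Conc.exists_map_eq_sup_principal f t fun p _ => ⟨hf p.1, hf p.2⟩

variable {M : Type*} [SemilatticeSup M] [OrderBot M]

theorem Conc.map_le_iff {τ : SupBotHom (Conc L A) M} {s : M} {α : Conc L A} :
    τ α ≤ s ↔ ∀ a b, α.1.rel a b → τ (Conc.principal a b) ≤ s := by
  refine ⟨fun h a b hab => (OrderHomClass.mono τ (Conc.principal_le.2 hab)).trans h, fun h => ?_⟩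
  obtain ⟨t, rfl⟩ := Conc.exists_eq_sup_principal α
  rw [map_finset_sup]
  exact Finset.sup_le fun p hp => h _ _
    (Conc.principal_le.1 (Finset.le_sup (f := fun p => Conc.principal p.1 p.2) hp))

/-- The congruence of all pairs whose principal congruence has image at most `s`. -/
def Con.ofLe (τ : SupBotHom (Conc L A) M) (s : M) : Con L A where
  rel a b := τ (Conc.principal a b) ≤ s
  equiv := by
    refine ⟨fun a => ?_, fun {a b} h => ?_, fun {a b c} h₁ h₂ => ?_⟩
    · have : Conc.principal a a = (⊥ : Conc L A) :=
        le_bot_iff.1 (Conc.principal_le.2 ((Con.equiv _).refl a))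
      rw [this, map_bot]
      exact bot_le
    · refine (OrderHomClass.mono τ (Conc.principal_le.2 ?_)).trans h
      exact (Con.equiv _).symm (Conc.principal_le.1 le_rfl)
    · refine (OrderHomClass.mono τ (Conc.principal_le.2 ?_)).trans
        ((map_sup τ _ _).le.trans (sup_le h₁ h₂))
      exact (Con.equiv _).trans (Conc.principal_le.1 le_sup_left)
        (Conc.principal_le.1 le_sup_right)
  compat {n} f x y h := by
    refine (OrderHomClass.mono τ (b := Finset.univ.sup fun i => Conc.principal (x i) (y i))
      (Conc.principal_le.2 ?_)).trans ?_
    · exact Con.compat _ f x y fun i => Conc.principal_le.1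
        (Finset.le_sup (f := fun i => (Conc.principal (x i) (y i) : Conc L A)) (Finset.mem_univ i))
    · rw [map_finset_sup]
      exact Finset.sup_le fun i _ => h i

theorem Con.le_ofLe {τ : SupBotHom (Conc L A) M} {s : M} {α : Conc L A} :
    α.1 ≤ Con.ofLe τ s ↔ τ α ≤ s :=
  Conc.map_le_iff.symm

theorem Con.ofLe_mono (τ : SupBotHom (Conc L A) M) {s t : M} (h : s ≤ t) :
    Con.ofLe τ s ≤ Con.ofLe τ t := fun _ _ h' => le_trans (b := s) h' h

end Principal

/-! ### Quotient algebras -/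

section Quotient

variable {L : FirstOrder.Language.{u, u}} [L.IsAlgebraic] {A C : Type u} [L.Structure A]
  [L.Structure C]

/-- The underlying set of the quotient algebra by a congruence. -/
def Con.Quot (α : Con L A) : Type u := Quotient (⟨α.rel, α.equiv⟩ : Setoid A)

noncomputable instance (α : Con L A) : L.Structure α.Quot where
  funMap f x := Quotient.mk _ (FirstOrder.Language.Structure.funMap f fun i => (x i).out)
  RelMap r := isEmptyElim r

/-- The canonical projection onto a quotient algebra. -/
noncomputable def Con.proj (α : Con L A) : A →[L] α.Quot where
  toFun := Quotient.mk _
  map_fun' f x := Quotient.sound (α.compat f _ _ fun i =>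
    α.equiv.symm (Quotient.mk_out (s := ⟨α.rel, α.equiv⟩) (x i)))
  map_rel' r := isEmptyElim r

theorem Con.proj_surjective (α : Con L A) : Function.Surjective α.proj := Quotient.mk_surjective

theorem Con.proj_eq_proj {α : Con L A} {a b : A} : α.proj a = α.proj b ↔ α.rel a b :=
  Quotient.eq (r := ⟨α.rel, α.equiv⟩)

/-- The homomorphism induced on a quotient algebra. -/
noncomputable def Con.lift (α : Con L A) (f : A →[L] C) (hf : ∀ a b, α.rel a b → f a = f b) :
    α.Quot →[L] C where
  toFun := Quotient.lift f hf
  map_fun' g x := by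
    obtain ⟨y, rfl⟩ : ∃ y : Fin _ → A, x = α.proj ∘ y :=
      ⟨fun i => (x i).out, funext fun i => (Quotient.out_eq _).symm⟩
    rw [← α.proj.map_fun]
    exact f.map_fun g y
  map_rel' r := isEmptyElim r

theorem Con.hom_ext {α : Con L A} {f g : α.Quot →[L] C} (h : ∀ a, f (α.proj a) = g (α.proj a)) :
    f = g := by
  ext x
  obtain ⟨a, rfl⟩ := α.proj_surjective x
  exact h a

/-- Because `α ≤ κ`, reading `κ` on representatives gives a congruence of the quotient whose inverse
image is `κ`. -/
theorem Con.le_of_map_proj_le {α β : Con L A} {κ : Con L A} (hκ : α ≤ κ)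
    (h : Con.map α.proj β ≤ Con.map α.proj κ) : β ≤ κ := by
  let κ' : Con L α.Quot :=
    { rel := fun x y => κ.rel x.out y.out
      equiv := ⟨fun _ => κ.equiv.refl _, fun h => κ.equiv.symm h, fun h h' => κ.equiv.trans h h'⟩
      compat := fun f x y hxy => by
        refine κ.equiv.trans (hκ _ _ (Quotient.mk_out (s := ⟨α.rel, α.equiv⟩) _))
          (κ.equiv.trans (κ.compat f _ _ hxy) (κ.equiv.symm (hκ _ _ ?_)))
        exact Quotient.mk_out (s := ⟨α.rel, α.equiv⟩) _ }
  have hout (a : A) : κ.rel (α.proj a).out a := hκ _ _ (Quotient.mk_out (s := ⟨α.rel, α.equiv⟩) a)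
  have h₁ : Con.map α.proj κ ≤ κ' := (Con.map_comap_gc _ _ _).2 fun a b hab =>
    κ.equiv.trans (hout a) (κ.equiv.trans hab (κ.equiv.symm (hout b)))
  intro a b hab
  have h₂ := (Con.map_comap_gc _ _ _).1 (h.trans h₁) a b hab
  exact κ.equiv.trans (κ.equiv.symm (hout a)) (κ.equiv.trans h₂ (hout b))

theorem exists_orderIso_of_surjective {Y M N : Type*} [PartialOrder M] [PartialOrder N]
    {f : Y → M} {g : Y → N} (hf : Function.Surjective f) (hg : Function.Surjective g)
    (h : ∀ a b, f a ≤ f b ↔ g a ≤ g b) : ∃ e : M ≃o N, ∀ a, e (f a) = g a := by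
  have key (a : Y) : g (Function.surjInv hf (f a)) = g a :=
    le_antisymm ((h _ _).1 (Function.surjInv_eq hf _).le) ((h _ _).1 (Function.surjInv_eq hf _).ge)
  let i : M ↪o N := OrderEmbedding.ofMapLEIff (fun x => g (Function.surjInv hf x)) fun x y => by
    rw [← h, Function.surjInv_eq hf, Function.surjInv_eq hf]
  exact ⟨RelIso.ofSurjective i fun n => (hg n).imp' f fun a ha => (key a).trans ha, key⟩

/-- Both `Conc` of the quotient and `M` are images of `Conc A`. They induce the same preorder there,
since by `hτ'` the inequality `τ α ≤ τ β` amounts to `α ≤ β` modulo the kernel. -/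
theorem exists_conc_quot_orderIso {M : Type u} [SemilatticeSup M] [OrderBot M]
    (τ : SupBotHom (Conc L A) M) (hτ : Function.Surjective τ)
    (hτ' : ∀ β : Conc L A, Con.ofLe τ (τ β) ≤ β.1 ⊔ Con.ofLe τ ⊥) :
    ∃ e : Conc L (Con.ofLe τ ⊥).Quot ≃o M, ∀ α, e (Conc.map (Con.ofLe τ ⊥).proj α) = τ α := by
  refine exists_orderIso_of_surjective (Conc.map_surjective (Con.proj_surjective _)) hτ
    fun α β => ⟨fun h => ?_, fun h => ?_⟩
  · refine Con.le_ofLe.1 (Con.le_of_map_proj_le (Con.ofLe_mono τ bot_le) (le_trans h ?_))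
    exact (Con.map_comap_gc (Con.ofLe τ ⊥).proj).monotone_l (Con.le_ofLe.2 le_rfl)
  · refine (Con.map_comap_gc (Con.ofLe τ ⊥).proj _ _).2
      ((Con.le_ofLe.2 h).trans ((hτ' β).trans (sup_le ?_ ?_)))
    · exact (Con.map_comap_gc (Con.ofLe τ ⊥).proj).le_u_l _
    · exact fun a b hab => Con.rel_of_eq (Con.map _ β.1) (Con.proj_eq_proj.2 hab)

end Quotient

/-! ### Small subalgebras -/

/-- Countably many stages suffice because every finite subset of the union lies in one stage. -/
theorem exists_closure_mk_le {A : Type u} {κ : Cardinal.{u}} (hκ : ℵ₀ ≤ κ)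
    (W : Finset A → Set A) (hW : ∀ Y, #(W Y) ≤ κ) :
    ∃ B : Set A, #B ≤ κ ∧ ∀ Y : Finset A, ↑Y ⊆ B → W Y ⊆ B := by
  classical
  let step (B : Set A) : Set A := B ∪ ⋃ Y : {Y : Finset A // ↑Y ⊆ B}, W Y
  let B (n : ℕ) : Set A := step^[n] ∅
  have hB (n : ℕ) : B (n + 1) = step (B n) := Function.iterate_succ_apply' _ _ _
  have hmono : Monotone B := monotone_nat_of_le_succ fun n => by
    rw [hB]; exact Set.subset_union_left
  have hcard (n : ℕ) : #(B n) ≤ κ := by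
    induction n with
    | zero => exact (mk_eq_zero (∅ : Set A)).le.trans bot_le
    | succ n ih =>
      rw [hB]
      refine (mk_union_le _ _).trans (add_le_of_le hκ ih (mk_iUnion_le_of_le hκ ?_ fun Y => hW _))
      refine (mk_le_of_injective (f := fun Y : {Y : Finset A // ↑Y ⊆ B n} =>
        Y.1.subtype (· ∈ B n)) fun Y Z h => ?_).trans ?_
      · have := congrArg (Finset.map (Function.Embedding.subtype _)) h
        rw [Finset.subtype_map_of_mem Y.2, Finset.subtype_map_of_mem Z.2] at this
        exact Subtype.ext this
      · rcases finite_or_infinite (B n) with hfin | hinf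
        · exact (lt_aleph0_of_finite _).le.trans hκ
        · exact (mk_finset_of_infinite _).le.trans ih
  refine ⟨⋃ n : ULift.{u} ℕ, B n.down, mk_iUnion_le_of_le hκ (by simpa using hκ) fun n => hcard _,
    fun Y hY => ?_⟩
  obtain ⟨n, hn⟩ : ∃ n, ↑Y ⊆ B n := by
    have hY' : ∀ y ∈ Y, ∃ n, y ∈ B n := fun y hy => by
      obtain ⟨n, hn⟩ := Set.mem_iUnion.1 (hY hy)
      exact ⟨n.down, hn⟩
    choose! n hn using hY'
    exact ⟨Y.sup n, fun y hy => hmono (Finset.le_sup hy) (hn y hy)⟩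
  refine fun a ha => Set.mem_iUnion.2 ⟨⟨n + 1⟩, ?_⟩
  change a ∈ B (n + 1)
  rw [hB]
  exact Or.inr (Set.mem_iUnion.2 ⟨⟨Y, hn⟩, ha⟩)

/-- `B x` is the least set closed under `W y` for all `y ≤ x`, which makes it monotone; the bound on
`Set.Iic x` keeps it small. -/
theorem exists_monotone_closure_mk_le {X A : Type u} [Preorder X] {κ : Cardinal.{u}} (hκ : ℵ₀ ≤ κ)
    (hX : ∀ x : X, #(Set.Iic x) ≤ κ) (W : X → Finset A → Set A) (hW : ∀ x Y, #(W x Y) ≤ κ) :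
    ∃ B : X → Set A, Monotone B ∧ (∀ x, #(B x) ≤ κ) ∧
      ∀ x (Y : Finset A), ↑Y ⊆ B x → W x Y ⊆ B x := by
  let B (x : X) : Set A := ⋂₀ {Z | ∀ y ≤ x, ∀ Y : Finset A, ↑Y ⊆ Z → W y Y ⊆ Z}
  refine ⟨B, fun x y hxy => ?_, fun x => ?_, fun x Y hY => ?_⟩
  · exact Set.sInter_subset_sInter fun Z hZ z hz => hZ z (hz.trans hxy)
  · obtain ⟨Z, hZ, hZ'⟩ := exists_closure_mk_le hκ (fun Y => ⋃ y : Set.Iic x, W y Y)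
      fun Y => mk_iUnion_le_of_le hκ (hX x) fun y => hW _ _
    refine (mk_le_mk_of_subset (Set.sInter_subset_of_mem fun y hy Y hY => ?_)).trans hZ
    exact (Set.subset_iUnion (fun y : Set.Iic x => W y Y) ⟨y, hy⟩).trans (hZ' Y hY)
  · exact Set.subset_sInter fun Z hZ =>
      hZ x le_rfl Y (hY.trans (Set.sInter_subset_of_mem hZ))

section Subalgebra

variable {L : FirstOrder.Language.{u, u}} {A : Type u} [L.Structure A]

/-- A derivation of `(a, b)` from `r` involves finitely many elements. Formally, the pairs with such
a `W` form a congruence containing `r`; compatibility uses that operations are finitary. -/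
theorem Con.exists_finset_gen_rel (r : A → A → Prop) {a b : A}
    (hab : (Con.gen r : Con L A).rel a b) :
    ∃ W : Finset A, ∀ B : L.Substructure A, ↑W ⊆ (B : Set A) → ∃ (ha : a ∈ B) (hb : b ∈ B),
      (Con.gen (fun u v : B => r u v) : Con L B).rel ⟨a, ha⟩ ⟨b, hb⟩ := by
  classical
  let θ : Con L A :=
    { rel := fun a b => ∃ W : Finset A, ∀ B : L.Substructure A, ↑W ⊆ (B : Set A) →
        ∃ (ha : a ∈ B) (hb : b ∈ B),
          (Con.gen (fun u v : B => r u v) : Con L B).rel ⟨a, ha⟩ ⟨b, hb⟩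
      equiv := by
        refine ⟨fun a => ⟨{a}, fun B hB => ?_⟩, ?_, ?_⟩
        · have ha : a ∈ B := hB (by simp)
          exact ⟨ha, ha, (Con.equiv _).refl _⟩
        · rintro a b ⟨W, hW⟩
          refine ⟨W, fun B hB => ?_⟩
          obtain ⟨ha, hb, h⟩ := hW B hB
          exact ⟨hb, ha, (Con.equiv _).symm h⟩
        · rintro a b c ⟨W, hW⟩ ⟨W', hW'⟩
          refine ⟨W ∪ W', fun B hB => ?_⟩
          rw [Finset.coe_union, Set.union_subset_iff] at hB
          obtain ⟨ha, hb, h⟩ := hW B hB.1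
          obtain ⟨_, hc, h'⟩ := hW' B hB.2
          exact ⟨ha, hc, (Con.equiv _).trans h h'⟩
      compat := by
        intro n f x y h
        choose W hW using h
        refine ⟨Finset.univ.biUnion W, fun B hB => ?_⟩
        have hB' (i) : ↑(W i) ⊆ (B : Set A) := fun a ha =>
          hB (Finset.mem_coe.2 (Finset.mem_biUnion.2 ⟨i, Finset.mem_univ i, ha⟩))
        choose hx hy hxy using fun i => hW i B (hB' i)
        exact ⟨B.fun_mem f x hx, B.fun_mem f y hy,
          Con.compat (Con.gen fun u v : B => r u v) f (fun i => ⟨x i, hx i⟩)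
            (fun i => ⟨y i, hy i⟩) hxy⟩ }
  refine (Con.gen_le (θ := θ)).2 (fun u v huv => ⟨{u, v}, fun B hB => ?_⟩) a b hab
  have hu : u ∈ B := hB (by simp)
  have hv : v ∈ B := hB (by simp)
  exact ⟨hu, hv, Con.gen_le.1 le_rfl _ _ huv⟩

variable {M : Type u} [SemilatticeSup M] [OrderBot M]

/-- The restriction to a subalgebra of a map defined on compact congruences. -/
def restrictConc (ρ : SupBotHom (Conc L A) M) (B : L.Substructure A) : SupBotHom (Conc L B) M :=
  ρ.comp (Conc.map B.subtype.toHom)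

theorem restrictConc_principal (ρ : SupBotHom (Conc L A) M) (B : L.Substructure A) (a b : B) :
    restrictConc ρ B (Conc.principal a b) = ρ (Conc.principal (a : A) b) :=
  congrArg ρ (Conc.map_principal _ a b)

/-- Membership in `t`, modulo the kernel congruence of `ρ`. -/
def pairRel (ρ : SupBotHom (Conc L A) M) (t : Finset (A × A)) (u v : A) : Prop :=
  (u, v) ∈ t ∨ (Con.ofLe ρ ⊥).rel u v

/-- `W` adds generators of a preimage of each element of `M`, which gives surjectivity, and the
elements used to derive pairs from finite sets modulo the kernel of `ρ`. By `hρ'`, a pair collapsed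
below the image of `β` has such a derivation in `A`; closure under `W` lets it run inside `B`. -/
theorem exists_closure_operator {κ : Cardinal.{u}} (hκ : ℵ₀ ≤ κ) (hM : #M ≤ κ)
    (ρ : SupBotHom (Conc L A) M) (hρ : Function.Surjective ρ)
    (hρ' : ∀ α β, ρ α ≤ ρ β → ∃ γ, ρ γ = ⊥ ∧ α ≤ β ⊔ γ) :
    ∃ W : Finset A → Set A, (∀ Y, #(W Y) ≤ κ) ∧
      ∀ B : L.Substructure A, (∀ Y : Finset A, ↑Y ⊆ (B : Set A) → W Y ⊆ B) →
        Function.Surjective (restrictConc ρ B) ∧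
        ∀ β, Con.ofLe (restrictConc ρ B) (restrictConc ρ B β) ≤
          β.1 ⊔ Con.ofLe (restrictConc ρ B) ⊥ := by
  classical
  choose W₁ hW₁ using fun (t : Finset (A × A)) (a b : A)
    (h : (Con.gen (pairRel ρ t) : Con L A).rel a b) => Con.exists_finset_gen_rel _ h
  have hgen (m : M) : ∃ t : Finset (A × A), ρ (t.sup fun p => Conc.principal p.1 p.2) = m := by
    obtain ⟨α, rfl⟩ := hρ m
    obtain ⟨t, rfl⟩ := Conc.exists_eq_sup_principal α
    exact ⟨t, rfl⟩
  choose g hg using hgen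
  let W₂ (t : Finset (A × A)) (a b : A) : Finset A :=
    if h : (Con.gen (pairRel ρ t) : Con L A).rel a b then W₁ t a b h else ∅
  let W (Y : Finset A) : Set A :=
    ↑((Y ×ˢ Y).powerset.biUnion fun t => Y.biUnion fun a => Y.biUnion fun b => W₂ t a b) ∪
      ⋃ m : M, ↑((g m).image Prod.fst ∪ (g m).image Prod.snd)
  refine ⟨W, fun Y => ?_, fun B hB => ⟨fun m => ?_, fun β a b hab => ?_⟩⟩
  · refine (mk_union_le _ _).trans (add_le_of_le hκ ?_ (mk_iUnion_le_of_le hκ hM fun m => ?_))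
    · exact (Finset.finite_toSet _).lt_aleph0.le.trans hκ
    · exact (Finset.finite_toSet _).lt_aleph0.le.trans hκ
  · have hm : ∀ p ∈ g m, p.1 ∈ B ∧ p.2 ∈ B := by
      have h : ⋃ m : M, ↑((g m).image Prod.fst ∪ (g m).image Prod.snd) ⊆ (B : Set A) :=
        Set.subset_union_right.trans (hB ∅ (by simp))
      intro p hp
      refine ⟨h (Set.mem_iUnion.2 ⟨m, ?_⟩), h (Set.mem_iUnion.2 ⟨m, ?_⟩)⟩
      · exact Finset.mem_union_left _ (Finset.mem_image_of_mem _ hp)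
      · exact Finset.mem_union_right _ (Finset.mem_image_of_mem _ hp)
    obtain ⟨α, hα⟩ := Conc.exists_map_eq_sup_principal B.subtype.toHom (g m) fun p hp =>
      ⟨⟨⟨p.1, (hm p hp).1⟩, rfl⟩, ⟨⟨p.2, (hm p hp).2⟩, rfl⟩⟩
    exact ⟨α, (congrArg ρ hα).trans (hg m)⟩
  · obtain ⟨s, hs⟩ := Conc.exists_eq_sup_principal β
    let t : Finset (A × A) := s.image fun p => ((p.1 : A), (p.2 : A))
    have h₁ : (Con.gen (pairRel ρ t) : Con L A).rel a b := by
      replace hab : ρ (Conc.principal (a : A) b) ≤ ρ (Conc.map B.subtype.toHom β) :=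
        (restrictConc_principal ρ B a b).symm.le.trans hab
      obtain ⟨γ, hγ, hle⟩ := hρ' _ _ hab
      refine Con.principal_le.1
        (le_trans (b := Con.map B.subtype.toHom β.1 ⊔ γ.1) hle (sup_le ?_ ?_))
      · refine (Con.map_comap_gc _ _ _).2 ?_
        rw [hs, Conc.coe_finset_sup]
        refine Finset.sup_le fun p hp => Con.principal_le.2 ?_
        exact Con.gen_le.1 le_rfl _ _ (Or.inl (Finset.mem_image_of_mem _ hp))
      · exact (Con.le_ofLe.2 hγ.le).trans fun u v huv => Con.gen_le.1 le_rfl _ _ (Or.inr huv)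
    let Y : Finset A := {(a : A), (b : A)} ∪ (t.image Prod.fst ∪ t.image Prod.snd)
    have ht : ∀ p ∈ t, p.1 ∈ B ∧ p.2 ∈ B := by
      intro p hp
      obtain ⟨q, _, rfl⟩ := Finset.mem_image.1 hp
      exact ⟨q.1.2, q.2.2⟩
    have hY : ↑Y ⊆ (B : Set A) := by
      intro c hc
      simp only [Y, Finset.coe_union, Set.mem_union, Finset.mem_coe, Finset.mem_insert,
        Finset.mem_singleton, Finset.mem_image] at hc
      rcases hc with (rfl | rfl) | ⟨p, hp, rfl⟩ | ⟨p, hp, rfl⟩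
      exacts [a.2, b.2, (ht p hp).1, (ht p hp).2]
    have hW₂ : ↑(W₂ t a b) ⊆ (B : Set A) := by
      refine fun c hc => hB Y hY (Or.inl (Finset.mem_coe.2 ?_))
      simp only [Finset.mem_biUnion, Finset.mem_powerset]
      refine ⟨t, fun p hp => Finset.mem_product.2 ⟨?_, ?_⟩, a, by simp [Y], b, by simp [Y], hc⟩
      · exact Finset.mem_union_right _ (Finset.mem_union_left _ (Finset.mem_image_of_mem _ hp))
      · exact Finset.mem_union_right _ (Finset.mem_union_right _ (Finset.mem_image_of_mem _ hp))
    obtain ⟨_, _, h⟩ := hW₁ t a b h₁ B (by simpa only [W₂, dif_pos h₁] using hW₂)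
    refine (Con.gen_le (θ := β.1 ⊔ Con.ofLe (restrictConc ρ B) ⊥)).2 (fun u v huv => ?_) a b h
    rcases huv with huv | huv
    · obtain ⟨p, hp, hpu⟩ := Finset.mem_image.1 huv
      obtain ⟨rfl, rfl⟩ : p.1 = u ∧ p.2 = v :=
        ⟨Subtype.ext (congrArg Prod.fst hpu), Subtype.ext (congrArg Prod.snd hpu)⟩
      refine Con.principal_le.1 (le_sup_of_le_left ?_)
      subst hs
      exact Finset.le_sup (f := fun p => (Conc.principal p.1 p.2 : Conc L B)) hp
    · refine Con.principal_le.1 (le_sup_of_le_right (Con.principal_le.2 ?_))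
      exact (restrictConc_principal ρ B u v).le.trans huv

theorem exists_substructure_closure_operator [Nonempty A] {κ : Cardinal.{u}} (hκ : ℵ₀ ≤ κ)
    (hL : #(Σ n, L.Functions n) ≤ κ) :
    ∃ W : Finset A → Set A, (∀ Y, #(W Y) ≤ κ) ∧
      ∀ B : Set A, (∀ Y : Finset A, ↑Y ⊆ B → W Y ⊆ B) →
        B.Nonempty ∧ ∃ B' : L.Substructure A, (B' : Set A) = B := by
  classical
  obtain ⟨a₀⟩ := ‹Nonempty A›
  let W (Y : Finset A) : Set A := {a₀} ∪ ⋃ f : Σ n, L.Functions n,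
    Set.range fun x : Fin f.1 → Y => FirstOrder.Language.Structure.funMap f.2 fun i => (x i : A)
  refine ⟨W, fun Y => ?_, fun B hB => ⟨⟨a₀, hB ∅ (by simp) (Or.inl rfl)⟩,
    ⟨B, fun {n} f x hx => ?_⟩, rfl⟩⟩
  · refine (mk_union_le _ _).trans (add_le_of_le hκ ?_ (mk_iUnion_le_of_le hκ hL fun f => ?_))
    · exact (Set.finite_singleton _).lt_aleph0.le.trans hκ
    · exact (Set.finite_range _).lt_aleph0.le.trans hκ
  · refine hB (Finset.univ.image x) ?_ (Or.inr (Set.mem_iUnion.2 ⟨⟨n, f⟩,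
      fun i => ⟨x i, Finset.mem_image_of_mem _ (Finset.mem_univ i)⟩, rfl⟩))
    simpa [Set.range_subset_iff] using hx

end Subalgebra

/-! ### Lifting diagrams -/

section Lifting

variable {L : FirstOrder.Language.{u, u}} {A B : Type u} [L.Structure A] [L.Structure B]

theorem Satisfies.of_surjective {e : L.Term ℕ × L.Term ℕ} (h : Satisfies L A e) (f : A →[L] B)
    (hf : Function.Surjective f) : Satisfies L B e := by
  intro v
  obtain ⟨w, rfl⟩ : ∃ w : ℕ → A, v = f ∘ w :=
    ⟨fun n => Function.surjInv hf (v n), funext fun n => (Function.surjInv_eq hf _).symm⟩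
  rw [FirstOrder.Language.HomClass.realize_term, FirstOrder.Language.HomClass.realize_term, h w]

theorem Satisfies.of_injective {e : L.Term ℕ × L.Term ℕ} (h : Satisfies L A e) (f : B →[L] A)
    (hf : Function.Injective f) : Satisfies L B e := by
  intro v
  apply hf
  rw [← FirstOrder.Language.HomClass.realize_term, ← FirstOrder.Language.HomClass.realize_term, h]

variable {E : Set (L.Term ℕ × L.Term ℕ)}

theorem DiagramHasLifting.congr {P : Type u} [PartialOrder P] {D D' : P ⥤ SemilatSupCat.{u}}
    (h : DiagramHasLifting L E D) (i : D ≅ D') : DiagramHasLifting L E D' := by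
  obtain ⟨F, ⟨j⟩⟩ := h
  exact ⟨F, ⟨j.trans i⟩⟩

theorem HasLifting.of_isoMem {𝒮 : SemilatSupCat.{u} → Prop} (h : ∀ S, 𝒮 S → HasLifting L E S)
    {X : SemilatSupCat.{u}} (hX : IsoMem 𝒮 X) : HasLifting L E X := by
  obtain ⟨Y, hY, ⟨i⟩⟩ := hX
  obtain ⟨A, ⟨j⟩⟩ := h Y hY
  exact ⟨A, ⟨j.trans i.symm⟩⟩

variable [L.IsAlgebraic]

/-- The quotient of a nonempty subalgebra, as a member of the variety. -/
noncomputable def Variety.quotSubalgebra (A : Variety L E) (B : L.Substructure A.carrier)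
    (hB : (B : Set A.carrier).Nonempty) (θ : Con L B) : Variety L E :=
  have : Nonempty B := hB.to_subtype
  { carrier := θ.Quot
    nonempty := ⟨θ.proj (Classical.arbitrary B)⟩
    satisfies := fun e he => ((A.satisfies e he).of_injective B.subtype.toHom
      B.subtype.injective).of_surjective θ.proj θ.proj_surjective }

/-- The maps `ρ p` need to be compatible only on principal congruences of pairs from `B p`: this
makes inclusions respect the kernels, and naturality can be tested on principal congruences. -/
theorem diagramHasLifting_of_subalgebras {P : Type u} [PartialOrder P] (A : Variety L E)
    (D : P ⥤ SemilatSupCat.{u}) (B : P → L.Substructure A.carrier) (hB : Monotone B)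
    (hne : ∀ p, (B p : Set A.carrier).Nonempty)
    (ρ : ∀ p, SupBotHom (Conc L A.carrier) (D.obj p))
    (hsurj : ∀ p, Function.Surjective (restrictConc (ρ p) (B p)))
    (hker : ∀ p β, Con.ofLe (restrictConc (ρ p) (B p)) (restrictConc (ρ p) (B p) β) ≤
      β.1 ⊔ Con.ofLe (restrictConc (ρ p) (B p)) ⊥)
    (hnat : ∀ p q (h : p ≤ q), ∀ a ∈ B p, ∀ b ∈ B p,
      D.map (homOfLE h) (ρ p (Conc.principal a b)) = ρ q (Conc.principal a b)) :
    DiagramHasLifting L E D := by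
  let θ (p : P) : Con L (B p) := Con.ofLe (restrictConc (ρ p) (B p)) ⊥
  let incl {p q : P} (h : p ≤ q) : B p →[L] B q :=
    (FirstOrder.Language.Substructure.inclusion (hB h)).toHom
  have hθ {p q : P} (h : p ≤ q) (a b : B p) (hab : (θ p).rel a b) :
      ((θ q).proj.comp (incl h)) a = ((θ q).proj.comp (incl h)) b := by
    refine Con.proj_eq_proj.2 ?_
    change restrictConc (ρ q) (B q) (Conc.principal (incl h a) (incl h b)) ≤ ⊥
    replace hab : ρ p (Conc.principal (a : A.carrier) b) ≤ ⊥ :=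
      (restrictConc_principal (ρ p) (B p) a b).symm.le.trans hab
    rw [restrictConc_principal]
    refine (hnat p q h a a.2 b b.2).symm.le.trans ?_
    rw [le_bot_iff.1 hab, map_bot]
  let F : P ⥤ Variety L E :=
    { obj := fun p => A.quotSubalgebra (B p) (hne p) (θ p)
      map := fun {p q} f => (θ p).lift ((θ q).proj.comp (incl (leOfHom f))) (hθ (leOfHom f))
      map_id := fun p => Con.hom_ext (α := θ p) (g := FirstOrder.Language.Hom.id L _) fun a => rfl
      map_comp := fun {p q r} f g => Con.hom_ext (α := θ p)
        (g := ((θ q).lift _ (hθ (leOfHom g))).comp ((θ p).lift _ (hθ (leOfHom f)))) fun a => rfl }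
  choose e he using fun p => exists_conc_quot_orderIso _ (hsurj p) (hker p)
  have he' (p : P) (a b : B p) : e p (Conc.principal ((θ p).proj a) ((θ p).proj b)) =
      ρ p (Conc.principal (a : A.carrier) b) := by
    rw [← Conc.map_principal]
    exact (he p _).trans (restrictConc_principal _ _ _ _)
  refine ⟨F, ⟨NatIso.ofComponents (fun p => (SemilatSupCat.Iso.mk (e p) :
    SemilatSupCat.of (Conc L (θ p).Quot) ≅ D.obj p)) fun {p q} f => ?_⟩⟩
  refine Conc.hom_ext (A := (θ p).Quot)
    (f := ((e q : SupBotHom _ _)).comp (Conc.map ((θ p).lift _ (hθ (leOfHom f)))))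
    (g := (ConcreteCategory.hom (D.map f)).comp (e p : SupBotHom _ _)) fun x y => ?_
  obtain ⟨a, rfl⟩ := (θ p).proj_surjective x
  obtain ⟨b, rfl⟩ := (θ p).proj_surjective y
  refine (congrArg (e q) (Conc.map_principal _ _ _)).trans ((he' q _ _).trans ?_)
  exact (hnat p q (leOfHom f) a a.2 b b.2).symm.trans
    (congrArg (ConcreteCategory.hom (D.map f)) (he' p a b).symm)

theorem HasFreeSections.diagramHasLifting {P : Type u} [PartialOrder P] [Nonempty P]
    (hP : HasFreeSections P) (D : P ⥤ SemilatSupCat.{u})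
    (h : ∀ (X : Type u) [PartialOrder X] [Nonempty X] (d : X →o P) (𝓕 : Set (Finset X))
      (h𝓕 : IsRetractionFamily 𝓕),
      HasLifting L E (condensate (d.monotone.functor ⋙ D) h𝓕).toCat) :
    DiagramHasLifting L E D := by
  let κ : Cardinal.{u} := max ℵ₀ #(P ⊕ (Σ n, L.Functions n) ⊕ (Σ p, D.obj p))
  have hκ : ℵ₀ ≤ κ := le_max_left _ _
  have hκP : #P ≤ κ := (mk_le_of_injective Sum.inl_injective).trans (le_max_right _ _)
  have hκL : #(Σ n, L.Functions n) ≤ κ :=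
    (mk_le_of_injective (Sum.inr_injective.comp Sum.inl_injective)).trans (le_max_right _ _)
  have hκD (p : P) : #(D.obj p) ≤ κ :=
    (mk_le_of_injective (Sum.inr_injective.comp
      (Sum.inr_injective.comp (sigma_mk_injective (i := p))))).trans (le_max_right _ _)
  obtain ⟨X, _, d, 𝓕, h₁, h₂, h₃, h₄⟩ := hP κ hκ hκP
  have h𝓕 : IsRetractionFamily 𝓕 := ⟨h₂, h₃⟩
  -- Even for the empty choice there is a section of the nonempty `P` into `X`.
  have : Nonempty X := by
    obtain ⟨σ, _⟩ := h₄ (fun _ => ∅) (fun _ => Set.empty_subset _) fun _ =>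
      (mk_eq_zero (∅ : Set (Finset X))).le.trans bot_le
    exact ⟨σ (Classical.arbitrary P)⟩
  obtain ⟨A, ⟨i⟩⟩ := h X d 𝓕 h𝓕
  have := A.nonempty
  let S : X ⥤ SemilatSupCat.{u} := d.monotone.functor ⋙ D
  let φ : SupBotHom (Conc L A.carrier) (condensate S h𝓕).toCat := i.hom
  let ψ : SupBotHom (condensate S h𝓕).toCat (Conc L A.carrier) := i.inv
  have hφψ (s) : φ (ψ s) = s := DFunLike.congr_fun (F := SupBotHom _ _) i.inv_hom_id s
  have hψφ (α) : ψ (φ α) = α := DFunLike.congr_fun (F := SupBotHom _ _) i.hom_inv_id α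
  let ρ (x : X) : SupBotHom (Conc L A.carrier) (S.obj x) := (condensateProj S h𝓕 x).comp φ
  have hρ (x : X) : Function.Surjective (ρ x) :=
    (condensateProj_surjective S h𝓕 x).comp fun s => ⟨ψ s, hφψ s⟩
  have hρ' (x : X) (α β) (hαβ : ρ x α ≤ ρ x β) : ∃ γ, ρ x γ = ⊥ ∧ α ≤ β ⊔ γ := by
    obtain ⟨u, hu, hle⟩ := exists_le_sup_of_condensateProj_le S h𝓕 x (φ α) (φ β) hαβ
    refine ⟨ψ u, (congrArg (condensateProj S h𝓕 x) (hφψ u)).trans hu, ?_⟩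
    have := OrderHomClass.mono ψ hle
    rwa [map_sup, hψφ, hψφ] at this
  obtain ⟨W₀, hW₀, hW₀'⟩ := exists_substructure_closure_operator (A := A.carrier) hκ hκL
  choose W hW hW' using fun x =>
    exists_closure_operator (M := S.obj x) hκ (hκD (d x)) (ρ x) (hρ x) (hρ' x)
  obtain ⟨B, hBmono, hBcard, hB⟩ := exists_monotone_closure_mk_le hκ h₁
    (fun x Y => W₀ Y ∪ W x Y)
    fun x Y => (mk_union_le _ _).trans (add_le_of_le hκ (hW₀ Y) (hW x Y))
  choose hBne B' hB' using fun x =>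
    hW₀' (B x) fun Y hY => Set.subset_union_left.trans (hB x Y hY)
  choose supp hsupp hsupp' using fun s : (condensate S h𝓕).toCat => s.2
  -- The obstacles at `x` are the supports of the principal congruences of pairs from `B x`, viewed
  -- in the condensate.
  let G (x : X) : Set (Finset X) :=
    Set.range fun z : B x × B x => supp (φ (Conc.principal z.1.1 z.2.1))
  obtain ⟨σ, hσ, hσ'⟩ := h₄ G
    (by rintro x _ ⟨z, rfl⟩; exact hsupp _)
    (fun x => mk_range_le.trans <| by
      rw [mk_prod, lift_id]; exact mul_le_of_le hκ (hBcard x) (hBcard x))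
  have hlift : DiagramHasLifting L E (σ.monotone.functor ⋙ S) := by
    refine diagramHasLifting_of_subalgebras A _ (fun p => B' (σ p)) (fun p q hpq => ?_)
      (fun p => ?_) (fun p => ρ (σ p)) (fun p => ?_) (fun p => ?_) fun p q hpq a ha b hb => ?_
    · rw [← SetLike.coe_subset_coe, hB', hB']
      exact hBmono (σ.monotone hpq)
    · rw [hB']
      exact hBne _
    · exact (hW' (σ p) _ fun Y hY => by
        rw [hB'] at hY ⊢
        exact Set.subset_union_right.trans (hB _ Y hY)).1
    · exact (hW' (σ p) _ fun Y hY => by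
        rw [hB'] at hY ⊢
        exact Set.subset_union_right.trans (hB _ Y hY)).2
    · rw [← SetLike.mem_coe, hB'] at ha hb
      exact (hsupp' (φ (Conc.principal a b))).map_eq (h₂ _ (hsupp _)) (σ.monotone hpq)
        (hσ' p q hpq _ ⟨(⟨a, ha⟩, ⟨b, hb⟩), rfl⟩)
  -- As `d (σ p) = p`, pulling `D` back along `d` and then `σ` returns `D`.
  refine hlift.congr (NatIso.ofComponents (fun p => D.mapIso (eqToIso (hσ p))) fun f => ?_)
  change D.map _ ≫ D.map _ = D.map _ ≫ D.map _
  rw [← D.map_comp, ← D.map_comp]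
  rfl

theorem IsFiniteProductOfWellFoundedTrees.nonempty {P : Type u} [PartialOrder P]
    (hP : IsFiniteProductOfWellFoundedTrees P) : Nonempty P := by
  obtain ⟨n, T, _, hT, ⟨e⟩⟩ := hP
  exact ⟨e.symm fun k => (hT k).exists_bot.choose⟩

end Lifting

end CongLift

/-! ### The two statements, differing only in why the condensate belongs to the class. -/

theorem corollaryC (L : FirstOrder.Language.{u, u}) [L.IsAlgebraic] (E : Set (L.Term ℕ × L.Term ℕ)) :
    (∀ 𝒮 : SemilatSupCat.{u} → Prop,
      CongLift.ClosedUnderFiniteProducts 𝒮 →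
      CongLift.ClosedUnderDirectedUnions 𝒮 →
      (∀ S, 𝒮 S → CongLift.HasLifting L E S) →
      ∀ (P : Type u) [PartialOrder P], CongLift.IsFiniteProductOfWellFoundedTrees P →
      ∀ D : P ⥤ SemilatSupCat.{u}, (∀ p, 𝒮 (D.obj p)) →
        CongLift.DiagramHasLifting L E D) ∧
    (∀ 𝒮 : SemilatSupCat.{u} → Prop,
      (∀ S, 𝒮 S → ∃ t : S, IsTop t) →
      CongLift.ClosedUnderFiniteProducts 𝒮 →
      CongLift.ClosedUnderDirectedUnionsWithTop 𝒮 →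
      (∀ S, 𝒮 S → CongLift.HasLifting L E S) →
      ∀ (P : Type u) [PartialOrder P], CongLift.IsFiniteProductOfWellFoundedTrees P →
      ∀ D : P ⥤ SemilatSupCat.{u}, (∀ p, 𝒮 (D.obj p)) → CongLift.PreservesTop D →
        CongLift.DiagramHasLifting L E D) := by
  refine ⟨fun 𝒮 h𝒮 h𝒮' hlift P _ hP D hD => ?_, fun 𝒮 htop h𝒮 h𝒮' hlift P _ hP D hD hD' => ?_⟩
  · have := hP.nonempty
    refine hP.hasFreeSections.diagramHasLifting D fun X _ _ d 𝓕 h𝓕 => ?_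
    exact CongLift.HasLifting.of_isoMem hlift
      (CongLift.isoMem_condensate _ h𝓕 𝒮 h𝒮 h𝒮' fun x => hD (d x))
  · have := hP.nonempty
    refine hP.hasFreeSections.diagramHasLifting D fun X _ _ d 𝓕 h𝓕 => ?_
    exact CongLift.HasLifting.of_isoMem hlift
      (CongLift.isoMem_condensate_of_preservesTop _ h𝓕 𝒮 h𝒮 h𝒮' htop (fun x => hD (d x))
        fun x y f t ht => hD' _ t ht)
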